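/- Let $G$ be a group with a left-invariant lattice order $\preceq$ (with meet $\wedge$), let $P=\{x\in G: 1\preceq x\}$ be its positive cone, and let $\Delta\in P$ define a Garside structure of finite type: the set of simple elements $[1,\Delta]=\{s: 1\preceq s\preceq\Delta\}$ is finite and generates $G$, $\Delta^{-1}P\Delta=P$, and for every $x\in P$ the lengths of the strict chains from $1$ to $x$ are bounded. Write $\tau(x)=\Delta^{-1}x\Delta$. The left normal form of $X\in G$ is the decomposition $X=\Delta^p x_1\cdots x_r$ with $p\in\mathbb Z$ maximal such that $\Delta^p\preceq X$, all $x_i\neq 1$, and $x_i=(x_i\cdots x_r)\wedge\Delta$ for $i=1,\dots,r$; put $\ell(X)=r$. The initial factor is $\iota(X)=\tau^{-p}(x_1)$ (and $\iota(X)=1$ if $r=0$), and the cycling of $X$ is $\mathbf c(X)=\iota(X)^{-1}X\,\iota(X)$. The super summit set $SSS(X)$ is the set of conjugates of $X$ of minimal $\ell$, and the ultra summit set $USS(X)$ is the set of $Y\in SSS(X)$ with $\mathbf c^n(Y)=Y$ for some $n>0$. The rigidity of $X$ is $\mathcal R(X)=k/r$ if $r>0$, where $k$ is the biggest integer in $\{0,\dots,r\}$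 such that the first $k$ factors (factors $\Delta$ included) of the left normal form of $x_1\cdots x_r\,\tau^{-p}(x_1)$ are precisely $x_1,\dots,x_k$; and $\mathcal R(X)=0$ if $r=0$. Let $X\in G$ with $\ell(X)\ge 1$. Then: 1. If $X\in USS(X)$, then $\mathcal R(X)\le\mathcal R(X^m)$ for every $m>1$. 2. If $X\in SSS(X)$, then $\mathcal R(X)\le\mathcal R(\mathbf c^t(X))$ for every $t\ge 1$. 3. If $X\in USS(X)$, then $\mathcal R(X)=\mathcal R(\mathbf c^t(X))$ for every $t\ge 1$. -/

import Mathlib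

/-!
A group `G` with a lattice order invariant under left multiplication is given by
`[Group G] [Lattice G] [MulLeftMono G]`.  The order `≤` is the prefix order, `⊓` is the (left) gcd,
and the positive cone is `Set.Ici (1 : G)`.
-/

namespace Garside

variable {G : Type*} [Group G] [Lattice G]

/-- `Δ` is the Garside element of a Garside structure of finite type on the group `G`, whose lattice
order (invariant under left multiplication, see `MulLeftMono`) is the prefix order. -/
structure IsGarsideElement (Δ : G) : Prop where
  /-- `Δ` is positive -/
  one_le : 1 ≤ Δ
  /-- the simple elements generate `G` -/
  closure_simple : Subgroup.closure (Set.Icc 1 Δ) = ⊤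
  /-- there are finitely many simple elements -/
  finite_simple : (Set.Icc 1 Δ).Finite
  /-- `Δ⁻¹ P Δ = P` -/
  conj_positive : (fun x => Δ⁻¹ * x * Δ) '' Set.Ici (1 : G) = Set.Ici 1
  /-- the positive cone is atomic: strict chains from `1` to a given positive `x` have bounded
  length -/
  atomic : ∀ x : G, 1 ≤ x → ∃ N : ℕ, ∀ s : LTSeries G, s.head = 1 → s.last = x → s.length ≤ N

/-- The list `x₁, …, x_r` consists of nontrivial elements such that `xᵢ = (xᵢ ⋯ x_r) ∧ Δ` for
every `i`. -/
def IsGreedy (Δ : G) : List G → Prop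
  | [] => True
  | x :: xs => x ≠ 1 ∧ x = (x :: xs).prod ⊓ Δ ∧ IsGreedy Δ xs

/-- `X = Δ ^ p * x₁ * ⋯ * x_r` is the left normal form of `X`. -/
structure IsLeftNormalForm (Δ X : G) (p : ℤ) (xs : List G) : Prop where
  eq_prod : X = Δ ^ p * xs.prod
  isGreatest : IsGreatest {q : ℤ | Δ ^ q ≤ X} p
  greedy : IsGreedy Δ xs

theorem IsGreedy.unique {Δ : G} : ∀ {xs ys : List G}, IsGreedy Δ xs → IsGreedy Δ ys → 1 ≤ Δ →
    xs.prod = ys.prod → xs = ys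
  | [], [], _, _, _, _ => rfl
  | [], y :: ys, _, hy, hΔ, h => by
      obtain ⟨h1, h2, _⟩ := hy
      rw [← h, List.prod_nil, inf_eq_left.2 hΔ] at h2
      exact absurd h2 h1
  | x :: xs, [], hx, _, hΔ, h => by
      obtain ⟨h1, h2, _⟩ := hx
      rw [h, List.prod_nil, inf_eq_left.2 hΔ] at h2
      exact absurd h2 h1
  | x :: xs, y :: ys, hx, hy, hΔ, h => by
      obtain ⟨_, hx2, hx3⟩ := hx
      obtain ⟨_, hy2, hy3⟩ := hy
      have hxy : x = y := by rw [hx2, hy2, h]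
      subst hxy
      rw [List.prod_cons, List.prod_cons] at h
      rw [IsGreedy.unique hx3 hy3 hΔ (mul_left_cancel h)]

theorem IsLeftNormalForm.unique {Δ X : G} (hΔ : 1 ≤ Δ) {p q : ℤ} {xs ys : List G}
    (h : IsLeftNormalForm Δ X p xs) (h' : IsLeftNormalForm Δ X q ys) : p = q ∧ xs = ys := by
  have hpq : p = q := h.isGreatest.unique h'.isGreatest
  subst hpq
  refine ⟨rfl, h.greedy.unique h'.greedy hΔ ?_⟩
  exact mul_left_cancel (h.eq_prod.symm.trans h'.eq_prod)

section existence

variable [MulLeftMono G] {Δ : G}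

theorem IsGarsideElement.mul_right_mono (hΔ : IsGarsideElement Δ) {a b : G} (h : a ≤ b) :
    a * Δ ≤ b * Δ := by
  have h1 : (1 : G) ≤ a⁻¹ * b := by simpa using mul_le_mul_right h a⁻¹
  have h2 : (1 : G) ≤ Δ⁻¹ * (a⁻¹ * b) * Δ := by
    have : Δ⁻¹ * (a⁻¹ * b) * Δ ∈ (fun x => Δ⁻¹ * x * Δ) '' Set.Ici (1 : G) := ⟨_, h1, rfl⟩
    rw [hΔ.conj_positive] at this
    exact this
  simpa [mul_assoc] using mul_le_mul_right h2 (a * Δ)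

theorem IsGarsideElement.mul_right_mono_pow (hΔ : IsGarsideElement Δ) {a b : G} (h : a ≤ b)
    (n : ℕ) : a * Δ ^ n ≤ b * Δ ^ n := by
  induction n with
  | zero => simpa using h
  | succ n ih => simpa [pow_succ, mul_assoc] using hΔ.mul_right_mono ih

theorem IsGarsideElement.exists_le_pow (hΔ : IsGarsideElement Δ) (X : G) :
    ∃ n : ℕ, X ≤ Δ ^ n ∧ X⁻¹ ≤ Δ ^ n := by
  have hX : X ∈ Subgroup.closure (Set.Icc 1 Δ) := by rw [hΔ.closure_simple]; trivial
  induction hX using Subgroup.closure_induction with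
  | mem x hx =>
      refine ⟨1, by simpa using hx.2, ?_⟩
      have : x⁻¹ ≤ 1 := by simpa using mul_le_mul_right hx.1 x⁻¹
      simpa using this.trans hΔ.one_le
  | one => exact ⟨0, by simp, by simp⟩
  | mul x y _ _ hx hy =>
      obtain ⟨a, ha, ha'⟩ := hx
      obtain ⟨b, hb, hb'⟩ := hy
      refine ⟨a + b, ?_, ?_⟩
      · calc x * y ≤ x * Δ ^ b := mul_le_mul_right hb x
          _ ≤ Δ ^ a * Δ ^ b := hΔ.mul_right_mono_pow ha b
          _ = Δ ^ (a + b) := (pow_add _ _ _).symm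
      · calc (x * y)⁻¹ = y⁻¹ * x⁻¹ := mul_inv_rev _ _
          _ ≤ y⁻¹ * Δ ^ a := mul_le_mul_right ha' _
          _ ≤ Δ ^ b * Δ ^ a := hΔ.mul_right_mono_pow hb' a
          _ = Δ ^ (a + b) := by rw [← pow_add, add_comm]
  | inv x _ hx =>
      obtain ⟨a, ha, ha'⟩ := hx
      exact ⟨a, ha', by simpa using ha⟩

theorem IsGarsideElement.inf_ne_one (hΔ : IsGarsideElement Δ) {Y : G} (hY : Y ≠ 1) :
    Y ⊓ Δ ≠ 1 := by
  intro h
  have hY1 : 1 ≤ Y := h ▸ inf_le_left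
  have key : ∀ n : ℕ, Y ⊓ Δ ^ n ≤ 1 := by
    intro n
    induction n with
    | zero => simp
    | succ k ih =>
      have h0 : Y ⊓ Δ ^ (k + 1) ≤ Δ ^ k := by
        have hk : (1 : G) ≤ Δ ^ k := one_le_pow_of_one_le' hΔ.one_le k
        set Z := Y ⊓ Δ ^ (k + 1) with hZ
        have a1 : Z ≤ Y * Δ ^ k :=
          inf_le_left.trans (by simpa using mul_le_mul_right hk Y)
        have a2 : Z ≤ Δ ^ (k + 1) := inf_le_right
        have inv_mono : ∀ {a b : G}, a ≤ b * Δ ^ k → a * (Δ ^ k)⁻¹ ≤ b := by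
          intro a b hab
          obtain ⟨x, hx, hxe⟩ : (a⁻¹ * (b * Δ ^ k)) ∈
              (fun x => (Δ ^ k)⁻¹ * x * Δ ^ k) '' Set.Ici (1 : G) := by
            have : ∀ n : ℕ, (fun x => (Δ ^ n)⁻¹ * x * Δ ^ n) '' Set.Ici (1 : G) = Set.Ici 1 := by
              intro n
              induction n with
              | zero => simp
              | succ n ihn =>
                conv_rhs => rw [← hΔ.conj_positive, ← ihn, Set.image_image]
                refine Set.image_congr fun x _ => ?_
                simp [pow_succ, mul_assoc]
            rw [this]
            simpa using mul_le_mul_right hab a⁻¹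
          have : x = Δ ^ k * a⁻¹ * b := by
            have := congrArg (fun z => Δ ^ k * z * (Δ ^ k)⁻¹) hxe
            simpa [mul_assoc] using this
          have hx' : 1 ≤ Δ ^ k * a⁻¹ * b := this ▸ hx
          simpa [mul_assoc] using mul_le_mul_right hx' (a * (Δ ^ k)⁻¹)
        have b1 := inv_mono a1
        have b2 : Z * (Δ ^ k)⁻¹ ≤ Δ := inv_mono (by rwa [pow_succ'] at a2)
        have b3 : Z * (Δ ^ k)⁻¹ ≤ 1 := h ▸ le_inf b1 b2
        simpa using hΔ.mul_right_mono_pow b3 k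
      exact (le_inf inf_le_left h0).trans ih
  obtain ⟨n, hn, _⟩ := hΔ.exists_le_pow Y
  exact hY (le_antisymm ((le_inf le_rfl hn).trans (key n)) hY1)

theorem IsGarsideElement.exists_greedy (hΔ : IsGarsideElement Δ) {Y : G} (hY : 1 ≤ Y) :
    ∃ xs : List G, IsGreedy Δ xs ∧ xs.prod = Y := by
  obtain ⟨N, hN⟩ := hΔ.atomic Y hY
  induction N generalizing Y with
  | zero =>
      by_cases h : Y = 1
      · exact ⟨[], trivial, by simp [h]⟩
      · have hlt : 1 < Y := lt_of_le_of_ne hY (Ne.symm h)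
        have := hN (RelSeries.cons (RelSeries.singleton _ Y) 1 hlt) rfl rfl
        exact absurd this (by simp [RelSeries.cons, RelSeries.append])
  | succ N ih =>
      by_cases h : Y = 1
      · exact ⟨[], trivial, by simp [h]⟩
      · set y := Y ⊓ Δ with hy
        have hy1 : y ≠ 1 := hΔ.inf_ne_one h
        have hy0 : 1 ≤ y := le_inf hY hΔ.one_le
        have hlt : 1 < y := lt_of_le_of_ne hy0 (Ne.symm hy1)
        have h1 : 1 ≤ y⁻¹ * Y := by
          have := mul_le_mul_right (inf_le_left : y ≤ Y) y⁻¹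
          rwa [inv_mul_cancel] at this
        obtain ⟨xs, hxs, hprod⟩ := ih h1 (by
          intro s hs hs'
          have hsm : StrictMono (fun x : G => y * x) := by
            intro a b hab
            exact lt_of_le_of_ne (mul_le_mul_right hab.le y) (fun e => hab.ne (mul_left_cancel e))
          have hhead : (s.map _ hsm).head = y := by simp [hs]
          have := hN ((s.map _ hsm).cons 1 (by rw [hhead]; exact hlt)) (by simp)
            (by simp [hs'])
          simpa using this)
        refine ⟨y :: xs, ⟨hy1, ?_, hxs⟩, by simp [hprod]⟩
        simp [hprod, hy]

/-- Left normal forms exist.  (If `Δ = 1`, then `G` is trivial.) -/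
theorem IsGarsideElement.exists_leftNormalForm (hΔ : IsGarsideElement Δ) (hne : Δ ≠ 1) (X : G) :
    ∃ p xs, IsLeftNormalForm Δ X p xs := by
  have h1 : 1 < Δ := lt_of_le_of_ne hΔ.one_le (Ne.symm hne)
  obtain ⟨n, hn, hn'⟩ := hΔ.exists_le_pow X
  have hneg : ∀ k : ℕ, 1 ≤ Δ ^ k := fun k => one_le_pow_of_one_le' hΔ.one_le k
  have hbdd : ∀ q : ℤ, Δ ^ q ≤ X → q ≤ n := by
    intro q hq
    by_contra hlt
    push Not at hlt
    obtain ⟨k, hk⟩ := Int.eq_ofNat_of_zero_le (by omega : 0 ≤ q - n - 1)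
    have e : q = (n : ℤ) + ((k + 1 : ℕ) : ℤ) := by push_cast; omega
    have h2 : Δ ^ n * Δ ^ (k + 1) ≤ Δ ^ n * 1 := by
      have := hq.trans hn
      rw [e, zpow_add, zpow_natCast, zpow_natCast] at this
      simpa using this
    have h3 : Δ ^ (k + 1) ≤ 1 := by simpa using mul_le_mul_right h2 (Δ ^ n)⁻¹
    have h4 : Δ ≤ Δ ^ (k + 1) := by
      rw [pow_succ']
      simpa using mul_le_mul_right (hneg k) Δ
    exact absurd (h4.trans h3) h1.not_ge
  have hmem : Δ ^ (-(n : ℤ)) ≤ X := by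
    have a : X * X⁻¹ ≤ X * Δ ^ n := mul_le_mul_right hn' X
    rw [mul_inv_cancel] at a
    have b : ∀ m : ℕ, ∀ {c : G}, 1 ≤ c * Δ ^ m → (Δ ^ m)⁻¹ ≤ c := by
      intro m c hc
      induction m generalizing c with
      | zero => simpa using hc
      | succ m ih =>
        have h5 : (Δ ^ m)⁻¹ ≤ c * Δ := ih (by rwa [mul_assoc, ← pow_succ'])
        have h6 : (1 : G) ≤ Δ ^ m * (c * Δ) := by
          simpa using mul_le_mul_right h5 (Δ ^ m)
        rw [← Set.mem_Ici, ← hΔ.conj_positive] at h6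
        obtain ⟨x, hx, hxe⟩ := h6
        have : x = Δ ^ (m + 1) * c := by
          have := congrArg (fun z => Δ * z * Δ⁻¹) hxe
          simpa [pow_succ', mul_assoc] using this
        have hx' : 1 ≤ Δ ^ (m + 1) * c := this ▸ hx
        simpa using mul_le_mul_right hx' (Δ ^ (m + 1))⁻¹
    simpa using b n a
  obtain ⟨p, hp, hpmax⟩ := Int.exists_greatest_of_bdd (P := fun q : ℤ => Δ ^ q ≤ X)
    ⟨n, hbdd⟩ ⟨_, hmem⟩
  have hpos : 1 ≤ (Δ ^ p)⁻¹ * X := by simpa using mul_le_mul_right hp (Δ ^ p)⁻¹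
  obtain ⟨xs, hxs, hprod⟩ := hΔ.exists_greedy hpos
  exact ⟨p, xs, by simp [hprod], ⟨hp, fun q hq => hpmax q hq⟩, hxs⟩

end existence

open Classical in
/-- The left normal form of `X`, as the pair of `p` and the list `x₁, …, x_r`. If there is none (only
when `G` is trivial), it is taken to be that of `Δ ^ 0`. -/
noncomputable def leftNormalForm (Δ X : G) : ℤ × List G :=
  if h : ∃ nf : ℤ × List G, IsLeftNormalForm Δ X nf.1 nf.2 then h.choose else (0, [])

/-- `inf(X) = p` -/
noncomputable def infimum (Δ X : G) : ℤ := (leftNormalForm Δ X).1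

/-- The non-`Δ` factors `x₁, …, x_r` of the left normal form of `X`. -/
noncomputable def factors (Δ X : G) : List G := (leftNormalForm Δ X).2

/-- `ℓ(X) = r` -/
noncomputable def canonicalLength (Δ X : G) : ℕ := (factors Δ X).length

/-- The shift map `τ(x) = Δ⁻¹ x Δ`. -/
def shift (Δ : G) : MulAut G := MulAut.conj Δ⁻¹

/-- The initial factor `ι(X) = τ⁻ᵖ(x₁)`, and `ι(X) = 1` if `r = 0`. -/
noncomputable def initialFactor (Δ X : G) : G :=
  (shift Δ ^ (-infimum Δ X)) ((factors Δ X).headD 1)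

/-- Cycling, `c(X) = ι(X)⁻¹ X ι(X)`. -/
noncomputable def cycling (Δ X : G) : G := (initialFactor Δ X)⁻¹ * X * initialFactor Δ X

/-- The super summit set: the conjugates of `X` of minimal canonical length. -/
def superSummitSet (Δ X : G) : Set G :=
  {Y | IsConj X Y ∧ ∀ Z, IsConj X Z → canonicalLength Δ Y ≤ canonicalLength Δ Z}

/-- The ultra summit set: the elements of the super summit set that are periodic under cycling. -/
def ultraSummitSet (Δ X : G) : Set G :=
  {Y | Y ∈ superSummitSet Δ X ∧ ∃ m : ℕ, 0 < m ∧ (cycling Δ)^[m] Y = Y}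

/-- All factors `Δ, …, Δ, y₁, …, y_t` of the left normal form of a positive element `Y`, each `Δ`
being counted as a factor. -/
noncomputable def allFactors (Δ Y : G) : List G :=
  List.replicate (infimum Δ Y).toNat Δ ++ factors Δ Y

open Classical in
/-- The largest `k ∈ {0, …, r}` such that the first `k` factors of the left normal form of
`x₁ ⋯ x_r τ⁻ᵖ(x₁)` are `x₁, …, x_k`, where `X = Δ ^ p x₁ ⋯ x_r` is in left normal form. -/
noncomputable def rigidityCount (Δ X : G) : ℕ :=
  Nat.findGreatest
    (fun k => (allFactors Δ ((factors Δ X).prod * initialFactor Δ X)).take k = (factors Δ X).take k)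
    (canonicalLength Δ X)

/-- The rigidity `R(X) = k / r`, and `R(X) = 0` if `r = 0`. -/
noncomputable def rigidity (Δ X : G) : ℚ :=
  if canonicalLength Δ X = 0 then 0 else (rigidityCount Δ X : ℚ) / (canonicalLength Δ X : ℚ)

end Garside

/-!
With `p = inf(X)`, the maps `A w = X w Δ ^ (-p)` and `D w = w Δ` commute and preserve meets, and so
does `C = A ⊓ D`. As long as cycling preserves the infimum, which it does in the super summit set,
`Cᵗ(1)` conjugates `X` to `cᵗ(X)`.

The first `k` factors of `X` survive multiplication by `ι(X) = C(1)` on the right if and only if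
`A (C 1) ⊓ Dᵏ 1 ≤ A 1`. Applying `C` transports this inequality from `1` to `C 1`, that is, from `X`
to `c(X)`, so the rigidity is monotone under cycling, hence constant on a periodic orbit.

For powers, periodicity gives arbitrarily large `M` such that `Cᴹ(1)` commutes with `X`. Left
multiplication by `Cᴹ(1)` then commutes with `A` and `D`, and cancelling it from
`Cᴹ(1) (Aᵐ 1 ⊓ Dᵐ 1) ≤ Cᵐ⁺ᴹ(1)` gives `Aᵐ 1 ⊓ Dᵐ 1 = Cᵐ 1`. If moreover `k ≥ 1`, then
`1, C 1, C² 1, …` are the partial products of a left weighted sequence, which yields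
`Aᵃ 1 ⊓ Dᵇ 1 ≤ Cᵇ 1` for all `a` and `b`, and `Cᵐᵏ 1 ≤ Aᵐ 1`. Since `Aᵐ` belongs to `Xᵐ` as `A`
does to `X`, the first `m * k` of the at most `m * r` factors of `Xᵐ` survive.
-/

namespace Garside

section CommutingInfHoms

variable {L : Type*} [SemilatticeInf L] {A B D : InfHom L L} {o : L}

theorem commute_inf_left {F : Type*} [FunLike F L L] [InfHomClass F L L] {f : F}
    (hA : Function.Commute A f) (hD : Function.Commute D f) :
    Function.Commute ⇑(A ⊓ D) f := fun w => by
  simp only [InfHom.inf_apply, map_inf, hA w, hD w]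

theorem iterate_inf_le_right (A D : InfHom L L) (n : ℕ) (w : L) :
    (⇑(A ⊓ D))^[n] w ≤ D^[n] w :=
  (OrderHomClass.mono (A ⊓ D)).iterate_le_of_le (fun _ => inf_le_right) n w

theorem iterate_inf_le (A D : InfHom L L) (i j : ℕ) (w : L) :
    (⇑(A ⊓ D))^[i + j] w ≤ A^[i] (D^[j] w) := by
  induction i with
  | zero =>
    rw [Nat.zero_add]
    exact iterate_inf_le_right A D j w
  | succ i ih =>
    rw [Nat.succ_add, Function.iterate_succ_apply', Function.iterate_succ_apply']
    exact inf_le_left.trans (OrderHomClass.mono A ih)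

theorem le_iterate_inf_iff (hAD : Function.Commute A D) {n : ℕ} {w z : L} :
    z ≤ (⇑(A ⊓ D))^[n] w ↔ ∀ i j, i + j = n → z ≤ A^[i] (D^[j] w) := by
  refine ⟨fun h i j hij => h.trans (hij ▸ iterate_inf_le A D i j w), fun h => ?_⟩
  induction n generalizing w with
  | zero => exact h 0 0 rfl
  | succ n ih =>
    have map_iterate_inf : (⇑(A ⊓ D))^[n] (A w ⊓ D w) =
        (⇑(A ⊓ D))^[n] (A w) ⊓ (⇑(A ⊓ D))^[n] (D w) :=
      Function.Semiconj₂.iterate (map_inf (A ⊓ D)) n _ _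
    rw [Function.iterate_succ_apply, InfHom.inf_apply, map_iterate_inf]
    refine le_inf (ih fun i j hij => ?_) (ih fun i j hij => ?_)
    · rw [← (hAD.iterate_right j) w, ← Function.iterate_succ_apply]
      exact h (i + 1) j (by omega)
    · rw [← Function.iterate_succ_apply]
      exact h i (j + 1) (by omega)

theorem iterate_inf_iterate_le_of_recurrent (hAD : Function.Commute A D) {g : L ≃o L}
    (hAg : Function.Commute A g) (hDg : Function.Commute D g) {m M : ℕ} (hmM : m ≤ M)
    (hg : (⇑(A ⊓ D))^[M] o = g o) : A^[m] o ⊓ D^[m] o ≤ (⇑(A ⊓ D))^[m] o := by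
  have hCg : Function.Commute ⇑(A ⊓ D) g := commute_inf_left hAg hDg
  rw [← g.le_iff_le, ← (hCg.iterate_left m) o, ← hg, ← Function.iterate_add_apply,
    le_iterate_inf_iff hAD]
  intro i j hij
  rcases Nat.le_total m i with hi | hj
  · calc g (A^[m] o ⊓ D^[m] o) ≤ g (A^[m] o) := g.monotone inf_le_left
      _ = A^[m] ((⇑(A ⊓ D))^[M] o) := by rw [hg, (hAg.iterate_left m) o]
      _ ≤ A^[m] (A^[i - m] (D^[j] o)) := by
        refine (OrderHomClass.mono A).iterate m ?_
        rw [show M = i - m + j by omega]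
        exact iterate_inf_le A D _ _ o
      _ = A^[i] (D^[j] o) := by rw [← Function.iterate_add_apply, Nat.add_sub_cancel' hi]
  · calc g (A^[m] o ⊓ D^[m] o) ≤ g (D^[m] o) := g.monotone inf_le_right
      _ = D^[m] ((⇑(A ⊓ D))^[M] o) := by rw [hg, (hDg.iterate_left m) o]
      _ ≤ D^[m] (A^[i] (D^[j - m] o)) := by
        refine (OrderHomClass.mono D).iterate m ?_
        rw [show M = i + (j - m) by omega]
        exact iterate_inf_le A D _ _ o
      _ = A^[i] (D^[j] o) := by
        rw [← (hAD.iterate_iterate i m) _, ← Function.iterate_add_apply,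
          Nat.add_sub_cancel' (by omega)]

theorem inf_iterate_le_of_weighted {u : ℕ → L} {d : L} (hd : d ≤ D d)
    (hsucc : ∀ j, u (j + 1) ≤ D (u j)) (hweighted : ∀ j, u (j + 2) ⊓ D (u j) ≤ u (j + 1))
    (hzero : u 1 ⊓ d ≤ u 0) {j n : ℕ} (hjn : j ≤ n) : u n ⊓ D^[j] d ≤ u j := by
  have adjacent : ∀ j, u (j + 1) ⊓ D^[j] d ≤ u j := by
    intro j
    induction j with
    | zero => exact hzero
    | succ j ih =>
      refine (le_inf inf_le_left ?_).trans (hweighted j)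
      calc u (j + 2) ⊓ D^[j + 1] d ≤ D (u (j + 1)) ⊓ D (D^[j] d) := by
            rw [Function.iterate_succ_apply']
            exact inf_le_inf_right _ (hsucc (j + 1))
        _ = D (u (j + 1) ⊓ D^[j] d) := (map_inf D _ _).symm
        _ ≤ D (u j) := OrderHomClass.mono D ih
  induction n, hjn using Nat.le_induction with
  | base => exact inf_le_left
  | succ n hjn ih =>
    have hDjn : D^[j] d ≤ D^[n] d := (OrderHomClass.mono D).monotone_iterate_of_le_map hd hjn
    exact (le_inf ((inf_le_inf_left _ hDjn).trans (adjacent n)) inf_le_right).trans ih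

/-- The first `k` steps `D` from `o` do not see the difference between `A ((A ⊓ D) o)` and `A o`.
When `A` and `D` are the maps `hΔ.normalizedMul X` and `hΔ.mulDelta` below and `o = 1`, this says
that multiplying by `ι(X)` on the right leaves the first `k` factors of `X` unchanged. -/
def IsRigid (A D : InfHom L L) (o : L) (k : ℕ) : Prop :=
  A ((A ⊓ D) o) ⊓ D^[k] o ≤ A o

namespace IsRigid

variable {k : ℕ}

theorem anti (hD : o ≤ D o) {l : ℕ} (hkl : k ≤ l) (h : IsRigid A D o l) : IsRigid A D o k :=
  (inf_le_inf_left _ ((OrderHomClass.mono D).monotone_iterate_of_le_map hD hkl)).trans h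

theorem inf_apply (hAD : Function.Commute A D) (h : IsRigid A D o k) :
    IsRigid A D ((A ⊓ D) o) k := by
  have hCA : Function.Commute ⇑(A ⊓ D) A := commute_inf_left (Function.Commute.refl A) hAD.symm
  have hCD : Function.Commute ⇑(A ⊓ D) D := commute_inf_left hAD (Function.Commute.refl D)
  have hC := OrderHomClass.mono (A ⊓ D) h
  rwa [map_inf, hCA, hCA, (hCD.iterate_right k) o] at hC

theorem weighted (hAD : Function.Commute A D) (hD : o ≤ D o) (hk : 1 ≤ k) (h : IsRigid A D o k)
    (j : ℕ) : (⇑(A ⊓ D))^[j + 2] o ⊓ D ((⇑(A ⊓ D))^[j] o) ≤ (⇑(A ⊓ D))^[j + 1] o := by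
  have hCD : Function.Commute ⇑(A ⊓ D) D := commute_inf_left hAD (Function.Commute.refl D)
  induction j with
  | zero => exact le_inf ((inf_le_inf_right _ inf_le_left).trans (h.anti hD hk)) inf_le_right
  | succ j ih =>
    have hC := OrderHomClass.mono (A ⊓ D) ih
    rw [map_inf, hCD] at hC
    simpa only [← Function.iterate_succ_apply' ⇑(A ⊓ D)] using hC

theorem iterate_inf_iterate_le (hAD : Function.Commute A D) (hA : o ≤ A o) (hD : o ≤ D o)
    (hrec : ∀ n, A^[n] o ⊓ D^[n] o ≤ (⇑(A ⊓ D))^[n] o) (hk : 1 ≤ k) (h : IsRigid A D o k)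
    (a b : ℕ) : A^[a] o ⊓ D^[b] o ≤ (⇑(A ⊓ D))^[b] o := by
  have hmono {F : InfHom L L} (hF : o ≤ F o) : Monotone fun n => F^[n] o :=
    (OrderHomClass.mono F).monotone_iterate_of_le_map hF
  calc A^[a] o ⊓ D^[b] o
      ≤ (A^[max a b] o ⊓ D^[max a b] o) ⊓ D^[b] o :=
        le_inf (inf_le_inf (hmono hA (le_max_left a b)) (hmono hD (le_max_right a b))) inf_le_right
    _ ≤ (⇑(A ⊓ D))^[max a b] o ⊓ D^[b] o := inf_le_inf_right _ (hrec _)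
    _ ≤ (⇑(A ⊓ D))^[b] o :=
        inf_iterate_le_of_weighted (u := fun n => (⇑(A ⊓ D))^[n] o) hD
          (fun j => (Function.iterate_succ_apply' _ j o).trans_le inf_le_right)
          (h.weighted hAD hD hk) inf_le_right (le_max_right a b)

theorem map_iterate_inf_inf_iterate_le (hAD : Function.Commute A D) (hD : o ≤ D o)
    (hk : 1 ≤ k) (h : IsRigid A D o k) {j n : ℕ} (hjn : j ≤ n) :
    A ((⇑(A ⊓ D))^[n] o) ⊓ D^[j + k] o ≤ A ((⇑(A ⊓ D))^[j] o) := by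
  have hDk : D^[k] o ≤ D (D^[k] o) := by
    rw [← Function.iterate_succ_apply' D, Function.iterate_succ_apply]
    exact (OrderHomClass.mono D).iterate k hD
  rw [Function.iterate_add_apply]
  refine inf_iterate_le_of_weighted (u := fun n => A ((⇑(A ⊓ D))^[n] o)) hDk
    (fun j => ?_) (fun j => ?_) h hjn
  · rw [← hAD, Function.iterate_succ_apply']
    exact OrderHomClass.mono A inf_le_right
  · rw [← hAD, ← map_inf]
    exact OrderHomClass.mono A (h.weighted hAD hD hk j)

theorem iterate_inf_mul_le (hAD : Function.Commute A D) (hA : o ≤ A o) (hD : o ≤ D o)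
    (hk : 1 ≤ k) (h : IsRigid A D o k) (m : ℕ) : (⇑(A ⊓ D))^[m * k] o ≤ A^[m] o := by
  induction m with
  | zero => rw [Nat.zero_mul]; rfl
  | succ m ih =>
    have le_map : (⇑(A ⊓ D))^[(m + 1) * k] o ≤ A ((⇑(A ⊓ D))^[(m + 1) * k] o) :=
      calc (⇑(A ⊓ D))^[(m + 1) * k] o ≤ (⇑(A ⊓ D))^[(m + 1) * k + 1] o :=
            (OrderHomClass.mono (A ⊓ D)).monotone_iterate_of_le_map (le_inf hA hD) (Nat.le_succ _)
        _ ≤ A ((⇑(A ⊓ D))^[(m + 1) * k] o) :=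
            (Function.iterate_succ_apply' _ _ o).trans_le inf_le_left
    calc (⇑(A ⊓ D))^[(m + 1) * k] o
        ≤ A ((⇑(A ⊓ D))^[(m + 1) * k] o) ⊓ D^[m * k + k] o :=
          le_inf le_map (by rw [← Nat.succ_mul]; exact iterate_inf_le_right A D _ o)
      _ ≤ A ((⇑(A ⊓ D))^[m * k] o) :=
          h.map_iterate_inf_inf_iterate_le hAD hD hk (Nat.mul_le_mul_right k m.le_succ)
      _ ≤ A (A^[m] o) := OrderHomClass.mono A ih
      _ = A^[m + 1] o := (Function.iterate_succ_apply' A m o).symm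

theorem iterate (hAD : Function.Commute A D) (hA : o ≤ A o) (hD : o ≤ D o)
    (hrec : ∀ n, A^[n] o ⊓ D^[n] o ≤ (⇑(A ⊓ D))^[n] o) (hk : 1 ≤ k) (h : IsRigid A D o k)
    {m : ℕ} (hB : ⇑B = A^[m]) : IsRigid B D o (m * k) :=
  calc B ((B ⊓ D) o) ⊓ D^[m * k] o ≤ B (B o) ⊓ D^[m * k] o :=
        inf_le_inf_right _ (OrderHomClass.mono B inf_le_left)
    _ = A^[m + m] o ⊓ D^[m * k] o := by rw [hB, Function.iterate_add_apply]
    _ ≤ (⇑(A ⊓ D))^[m * k] o := h.iterate_inf_iterate_le hAD hA hD hrec hk _ _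
    _ ≤ A^[m] o := h.iterate_inf_mul_le hAD hA hD hk m
    _ = B o := by rw [hB]

end IsRigid

end CommutingInfHoms

variable {G : Type*} [Group G] [Lattice G]

/-- `Δ` is positive, right multiplication by `Δ` preserves and reflects the order, and every element
has a left normal form. Unlike in `IsGarsideElement`, there may be infinitely many simple
elements. -/
structure AdmitsLeftNormalForms (Δ : G) : Prop where
  one_le : 1 ≤ Δ
  mul_le_mul_iff : ∀ {a b : G}, a * Δ ≤ b * Δ ↔ a ≤ b
  exists_leftNormalForm : ∀ X : G, ∃ p xs, IsLeftNormalForm Δ X p xs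

variable {Δ : G}

theorem exists_leftNormalForm_of_canonicalLength_ne_zero {X : G} (hX : canonicalLength Δ X ≠ 0) :
    ∃ nf : ℤ × List G, IsLeftNormalForm Δ X nf.1 nf.2 := by
  by_contra hnone
  rw [canonicalLength, factors, leftNormalForm, dif_neg hnone] at hX
  exact hX rfl

theorem IsLeftNormalForm.ne_one {X : G} {p : ℤ} {xs : List G} (h : IsLeftNormalForm Δ X p xs) :
    Δ ≠ 1 := by
  rintro rfl
  have hmem : (1 : G) ^ (p + 1) ≤ X := by simpa using h.isGreatest.1
  exact (Int.lt_succ p).not_ge (h.isGreatest.2 hmem)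

theorem isConj_cycling (Δ X : G) : IsConj X (cycling Δ X) :=
  isConj_iff.2 ⟨(initialFactor Δ X)⁻¹, by simp [cycling]⟩

theorem initialFactor_mul_cycling (Δ X : G) :
    initialFactor Δ X * cycling Δ X = X * initialFactor Δ X := by
  simp [cycling, mul_assoc]

theorem rigidity_eq_div (Δ X : G) :
    rigidity Δ X = (rigidityCount Δ X : ℚ) / (canonicalLength Δ X : ℚ) := by
  unfold rigidity
  split_ifs with h
  · simp [h]
  · rfl

open Classical in
theorem rigidityCount_le_canonicalLength (Δ X : G) : rigidityCount Δ X ≤ canonicalLength Δ X :=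
  Nat.findGreatest_le _

theorem rigidity_nonneg (Δ X : G) : 0 ≤ rigidity Δ X := by
  rw [rigidity_eq_div]
  positivity

theorem rigidity_le_one (Δ X : G) : rigidity Δ X ≤ 1 := by
  rw [rigidity_eq_div]
  exact div_le_one_of_le₀ (mod_cast rigidityCount_le_canonicalLength Δ X) (Nat.cast_nonneg _)

namespace AdmitsLeftNormalForms

theorem ne_one (hΔ : AdmitsLeftNormalForms Δ) : Δ ≠ 1 := by
  obtain ⟨p, xs, h⟩ := hΔ.exists_leftNormalForm 1
  exact h.ne_one

theorem mul_zpow_le_mul_zpow_iff (hΔ : AdmitsLeftNormalForms Δ) {a b : G} (q : ℤ) :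
    a * Δ ^ q ≤ b * Δ ^ q ↔ a ≤ b := by
  induction q using Int.induction_on generalizing a b with
  | zero => simp
  | succ n ih => rw [zpow_add_one, ← mul_assoc, ← mul_assoc, hΔ.mul_le_mul_iff, ih]
  | pred n ih =>
    rw [← hΔ.mul_le_mul_iff, mul_assoc, mul_assoc, ← zpow_add_one, sub_add_cancel, ih]

theorem inf_mul_zpow (hΔ : AdmitsLeftNormalForms Δ) (a b : G) (q : ℤ) :
    (a ⊓ b) * Δ ^ q = a * Δ ^ q ⊓ b * Δ ^ q :=
  OrderIso.map_inf ⟨Equiv.mulRight (Δ ^ q), hΔ.mul_zpow_le_mul_zpow_iff q⟩ a b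

theorem isLeftNormalForm (hΔ : AdmitsLeftNormalForms Δ) (X : G) :
    IsLeftNormalForm Δ X (infimum Δ X) (factors Δ X) := by
  obtain ⟨p, xs, h⟩ := hΔ.exists_leftNormalForm X
  have hex : ∃ nf : ℤ × List G, IsLeftNormalForm Δ X nf.1 nf.2 := ⟨(p, xs), h⟩
  rw [infimum, factors, leftNormalForm, dif_pos hex]
  exact hex.choose_spec

theorem zpow_infimum_le (hΔ : AdmitsLeftNormalForms Δ) (X : G) : Δ ^ infimum Δ X ≤ X :=
  (hΔ.isLeftNormalForm X).isGreatest.1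

theorem zpow_infimum_mul_prod_factors (hΔ : AdmitsLeftNormalForms Δ) (X : G) :
    Δ ^ infimum Δ X * (factors Δ X).prod = X :=
  (hΔ.isLeftNormalForm X).eq_prod.symm

theorem initialFactor_eq_one_iff (hΔ : AdmitsLeftNormalForms Δ) {X : G} :
    initialFactor Δ X = 1 ↔ canonicalLength Δ X = 0 := by
  have hgreedy := (hΔ.isLeftNormalForm X).greedy
  rw [initialFactor, EmbeddingLike.map_eq_one_iff, canonicalLength, List.length_eq_zero_iff]
  rcases hfactors : factors Δ X with _ | ⟨x, xs⟩
  · simp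
  · rw [hfactors] at hgreedy
    simpa using hgreedy.1

theorem cycling_eq_self (hΔ : AdmitsLeftNormalForms Δ) {X : G}
    (hX : canonicalLength Δ X = 0) :
    cycling Δ X = X := by
  simp [cycling, hΔ.initialFactor_eq_one_iff.2 hX]

/-- Right multiplication by `Δ`. -/
def mulDelta (hΔ : AdmitsLeftNormalForms Δ) : InfHom G G where
  toFun w := w * Δ
  map_inf' a b := by simpa using hΔ.inf_mul_zpow a b 1

theorem mulDelta_apply (hΔ : AdmitsLeftNormalForms Δ) (w : G) : hΔ.mulDelta w = w * Δ :=
  rfl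

theorem iterate_mulDelta (hΔ : AdmitsLeftNormalForms Δ) (n : ℕ) (w : G) :
    hΔ.mulDelta^[n] w = w * Δ ^ n :=
  congrFun (mul_right_iterate Δ n) w

theorem one_le_mulDelta (hΔ : AdmitsLeftNormalForms Δ) : 1 ≤ hΔ.mulDelta 1 :=
  hΔ.one_le.trans_eq (one_mul Δ).symm

end AdmitsLeftNormalForms

variable [MulLeftMono G]

theorem IsGarsideElement.mul_le_mul_iff (hΔ : IsGarsideElement Δ) {a b : G} :
    a * Δ ≤ b * Δ ↔ a ≤ b := by
  refine ⟨fun h => ?_, hΔ.mul_right_mono⟩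
  have hconj : Δ⁻¹ * (a⁻¹ * b) * Δ ∈ Set.Ici (1 : G) := by
    simpa [mul_assoc] using mul_le_mul_right h (a * Δ)⁻¹
  rw [← hΔ.conj_positive] at hconj
  obtain ⟨x, hx, hxe⟩ := hconj
  obtain rfl : x = a⁻¹ * b := mul_left_cancel (mul_right_cancel hxe)
  exact le_inv_mul_iff_le.1 hx

theorem IsGarsideElement.admitsLeftNormalForms (hΔ : IsGarsideElement Δ) (hne : Δ ≠ 1) :
    AdmitsLeftNormalForms Δ :=
  ⟨hΔ.one_le, hΔ.mul_le_mul_iff, hΔ.exists_leftNormalForm hne⟩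

theorem IsGreedy.one_le_prod_of_cons {x : G} {xs : List G} (h : IsGreedy Δ (x :: xs)) :
    1 ≤ xs.prod := by
  have : x ≤ x * xs.prod := h.2.1.trans_le (inf_le_left.trans_eq List.prod_cons)
  exact (le_mul_iff_one_le_right' x).1 this

namespace AdmitsLeftNormalForms

theorem one_le_pow (hΔ : AdmitsLeftNormalForms Δ) (n : ℕ) : 1 ≤ Δ ^ n :=
  one_le_pow_of_one_le' hΔ.one_le n

theorem zpow_mono (hΔ : AdmitsLeftNormalForms Δ) : Monotone fun q : ℤ => Δ ^ q := by
  intro q s hqs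
  obtain ⟨n, rfl⟩ := Int.le.dest hqs
  simp only [zpow_add, zpow_natCast]
  exact le_mul_of_one_le_right' (hΔ.one_le_pow n)

end AdmitsLeftNormalForms

section Greedy

variable {xs ys : List G}

theorem IsGreedy.prod_take (h : IsGreedy Δ xs) (hΔ : AdmitsLeftNormalForms Δ)
    (hpos : 1 ≤ xs.prod) (k : ℕ) : (xs.take k).prod = xs.prod ⊓ Δ ^ k := by
  induction xs generalizing k with
  | nil => simpa using (inf_eq_left.2 (hΔ.one_le_pow k)).symm
  | cons x xs ih =>
    rcases k with _ | k
    · simpa using hpos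
    set Y := (x :: xs).prod with hY
    have hx : x * Δ ^ k = Y * Δ ^ k ⊓ Δ ^ (k + 1) := by
      conv_lhs => rw [h.2.1]
      simpa only [zpow_natCast, ← pow_succ'] using hΔ.inf_mul_zpow Y Δ k
    calc ((x :: xs).take (k + 1)).prod = x * (xs.prod ⊓ Δ ^ k) := by
          rw [List.take_succ_cons, List.prod_cons, ih h.2.2 h.one_le_prod_of_cons]
      _ = (Y ⊓ Y * Δ ^ k) ⊓ Δ ^ (k + 1) := by
          rw [mul_inf, ← List.prod_cons, ← hY, hx, inf_assoc]
      _ = Y ⊓ Δ ^ (k + 1) := by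
          rw [inf_eq_left.2 (le_mul_of_one_le_right' (hΔ.one_le_pow k))]

theorem IsGreedy.take (h : IsGreedy Δ xs) (hΔ : AdmitsLeftNormalForms Δ) (hpos : 1 ≤ xs.prod)
    (k : ℕ) : IsGreedy Δ (xs.take k) := by
  induction xs generalizing k with
  | nil => rwa [List.take_nil]
  | cons x xs ih =>
    rcases k with _ | k
    · trivial
    have hle : (x :: xs.take k).prod ≤ (x :: xs).prod := by
      rw [← List.take_succ_cons, h.prod_take hΔ hpos]
      exact inf_le_left
    have hge : x ≤ (x :: xs.take k).prod := by
      rw [List.prod_cons, h.2.2.prod_take hΔ h.one_le_prod_of_cons]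
      exact le_mul_of_one_le_right' (le_inf h.one_le_prod_of_cons (hΔ.one_le_pow k))
    exact ⟨h.1, le_antisymm (le_inf hge (h.2.1.trans_le inf_le_right))
      ((inf_le_inf_right Δ hle).trans_eq h.2.1.symm), ih h.2.2 h.one_le_prod_of_cons k⟩

theorem IsGreedy.take_eq_take_iff (hx : IsGreedy Δ xs) (hy : IsGreedy Δ ys)
    (hΔ : AdmitsLeftNormalForms Δ) (hxpos : 1 ≤ xs.prod) (hypos : 1 ≤ ys.prod) (k : ℕ) :
    xs.take k = ys.take k ↔ xs.prod ⊓ Δ ^ k = ys.prod ⊓ Δ ^ k := by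
  rw [← hx.prod_take hΔ hxpos, ← hy.prod_take hΔ hypos]
  exact ⟨congrArg List.prod, (hx.take hΔ hxpos k).unique (hy.take hΔ hypos k) hΔ.one_le⟩

theorem IsGreedy.length_le_iff (h : IsGreedy Δ xs) (hΔ : AdmitsLeftNormalForms Δ)
    (hpos : 1 ≤ xs.prod) (n : ℕ) : xs.length ≤ n ↔ xs.prod ≤ Δ ^ n := by
  rw [← List.take_eq_self_iff, ← inf_eq_left, ← h.prod_take hΔ hpos]
  exact ⟨congrArg List.prod, (h.take hΔ hpos n).unique h hΔ.one_le⟩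

theorem IsGreedy.replicate_append (h : IsGreedy Δ xs) (hΔ : AdmitsLeftNormalForms Δ)
    (hpos : 1 ≤ xs.prod) (n : ℕ) : IsGreedy Δ (List.replicate n Δ ++ xs) := by
  induction n with
  | zero => simpa using h
  | succ n ih =>
    rw [List.replicate_succ, List.cons_append]
    refine ⟨hΔ.ne_one, (inf_eq_right.2 ?_).symm, ih⟩
    rw [List.prod_cons, List.prod_append, List.prod_replicate]
    exact le_mul_of_one_le_right' (one_le_mul (hΔ.one_le_pow n) hpos)

end Greedy

namespace AdmitsLeftNormalForms

theorem le_infimum_iff (hΔ : AdmitsLeftNormalForms Δ) {X : G} {q : ℤ} :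
    q ≤ infimum Δ X ↔ Δ ^ q ≤ X :=
  ⟨fun h => (hΔ.zpow_mono h).trans (hΔ.zpow_infimum_le X),
    fun h => (hΔ.isLeftNormalForm X).isGreatest.2 h⟩

theorem one_le_prod_factors (hΔ : AdmitsLeftNormalForms Δ) (X : G) : 1 ≤ (factors Δ X).prod := by
  rw [← le_mul_iff_one_le_right' (Δ ^ infimum Δ X), hΔ.zpow_infimum_mul_prod_factors]
  exact hΔ.zpow_infimum_le X

theorem canonicalLength_le_iff (hΔ : AdmitsLeftNormalForms Δ) {X : G} {n : ℕ} :
    canonicalLength Δ X ≤ n ↔ X ≤ Δ ^ (infimum Δ X + n) := by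
  rw [canonicalLength, (hΔ.isLeftNormalForm X).greedy.length_le_iff hΔ (hΔ.one_le_prod_factors X),
    ← mul_le_mul_iff_left (Δ ^ infimum Δ X), hΔ.zpow_infimum_mul_prod_factors, zpow_add,
    zpow_natCast]

theorem le_zpow_infimum_add_canonicalLength (hΔ : AdmitsLeftNormalForms Δ) (X : G) :
    X ≤ Δ ^ (infimum Δ X + canonicalLength Δ X) :=
  hΔ.canonicalLength_le_iff.1 le_rfl

theorem canonicalLength_le_of_le (hΔ : AdmitsLeftNormalForms Δ) {X : G} {p : ℤ} {n : ℕ}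
    (hp : p ≤ infimum Δ X) (hX : X ≤ Δ ^ (p + n)) : canonicalLength Δ X ≤ n :=
  hΔ.canonicalLength_le_iff.2 (hX.trans (hΔ.zpow_mono (by omega)))

theorem add_infimum_le_infimum_mul (hΔ : AdmitsLeftNormalForms Δ) (X Y : G) :
    infimum Δ X + infimum Δ Y ≤ infimum Δ (X * Y) := by
  rw [hΔ.le_infimum_iff, zpow_add]
  exact ((hΔ.mul_zpow_le_mul_zpow_iff _).2 (hΔ.zpow_infimum_le X)).trans
    (mul_le_mul_right (hΔ.zpow_infimum_le Y) X)

theorem canonicalLength_mul_le (hΔ : AdmitsLeftNormalForms Δ) (X Y : G) :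
    canonicalLength Δ (X * Y) ≤ canonicalLength Δ X + canonicalLength Δ Y := by
  refine hΔ.canonicalLength_le_of_le (hΔ.add_infimum_le_infimum_mul X Y) ?_
  calc X * Y ≤ X * Δ ^ (infimum Δ Y + canonicalLength Δ Y) :=
        mul_le_mul_right (hΔ.le_zpow_infimum_add_canonicalLength Y) X
    _ ≤ Δ ^ (infimum Δ X + canonicalLength Δ X) * Δ ^ (infimum Δ Y + canonicalLength Δ Y) :=
        (hΔ.mul_zpow_le_mul_zpow_iff _).2 (hΔ.le_zpow_infimum_add_canonicalLength X)
    _ = Δ ^ (infimum Δ X + infimum Δ Y + (canonicalLength Δ X + canonicalLength Δ Y : ℕ)) := by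
        rw [← zpow_add]
        congr 1
        push_cast
        ring

theorem canonicalLength_pow_le (hΔ : AdmitsLeftNormalForms Δ) (X : G) (m : ℕ) :
    canonicalLength Δ (X ^ m) ≤ m * canonicalLength Δ X := by
  induction m with
  | zero =>
    rw [pow_zero, Nat.zero_mul]
    exact hΔ.canonicalLength_le_of_le (p := 0) (hΔ.le_infimum_iff.2 (by simp)) (by simp)
  | succ m ih =>
    rw [pow_succ, Nat.succ_mul]
    exact (hΔ.canonicalLength_mul_le _ _).trans (Nat.add_le_add_right ih _)

theorem initialFactor_eq (hΔ : AdmitsLeftNormalForms Δ) (X : G) :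
    initialFactor Δ X = X * Δ ^ (-infimum Δ X) ⊓ Δ := by
  have shift_zpow_apply (q : ℤ) (x : G) : (shift Δ ^ q) x = Δ ^ (-q) * x * Δ ^ q := by
    rw [shift, ← map_zpow, MulAut.conj_apply]
    simp
  have headD_eq_inf {xs : List G} (h : IsGreedy Δ xs) : xs.headD 1 = xs.prod ⊓ Δ := by
    rcases xs with _ | ⟨x, xs⟩
    · simpa using hΔ.one_le
    · exact h.2.1
  rw [initialFactor, shift_zpow_apply, headD_eq_inf (hΔ.isLeftNormalForm X).greedy, neg_neg,
    mul_inf, hΔ.zpow_infimum_mul_prod_factors, hΔ.inf_mul_zpow, ← zpow_add_one, ← zpow_add]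
  simp

theorem one_le_initialFactor (hΔ : AdmitsLeftNormalForms Δ) (X : G) : 1 ≤ initialFactor Δ X := by
  rw [hΔ.initialFactor_eq]
  refine le_inf ?_ hΔ.one_le
  rw [← hΔ.mul_zpow_le_mul_zpow_iff (infimum Δ X)]
  simpa using hΔ.zpow_infimum_le X

theorem initialFactor_ne_delta (hΔ : AdmitsLeftNormalForms Δ) (X : G) : initialFactor Δ X ≠ Δ := by
  intro h
  rw [hΔ.initialFactor_eq, inf_eq_right, ← hΔ.mul_zpow_le_mul_zpow_iff (infimum Δ X), mul_assoc,
    ← zpow_add, neg_add_cancel, zpow_zero, mul_one, ← zpow_one_add, ← hΔ.le_infimum_iff] at h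
  omega

theorem prod_allFactors (hΔ : AdmitsLeftNormalForms Δ) {Z : G} (hZ : 1 ≤ Z) :
    (allFactors Δ Z).prod = Z := by
  have hinf : 0 ≤ infimum Δ Z := hΔ.le_infimum_iff.2 (by simpa using hZ)
  rw [allFactors, List.prod_append, List.prod_replicate, ← zpow_natCast, Int.toNat_of_nonneg hinf,
    hΔ.zpow_infimum_mul_prod_factors]

theorem isGreedy_allFactors (hΔ : AdmitsLeftNormalForms Δ) (Z : G) :
    IsGreedy Δ (allFactors Δ Z) :=
  (hΔ.isLeftNormalForm Z).greedy.replicate_append hΔ (hΔ.one_le_prod_factors Z) _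

theorem take_allFactors_eq_take_factors_iff (hΔ : AdmitsLeftNormalForms Δ) (X : G) (k : ℕ) :
    (allFactors Δ ((factors Δ X).prod * initialFactor Δ X)).take k = (factors Δ X).take k ↔
      X * initialFactor Δ X ⊓ Δ ^ (infimum Δ X + k) ≤ X := by
  set x := (factors Δ X).prod
  have hx : 1 ≤ x := hΔ.one_le_prod_factors X
  have hle : x ≤ x * initialFactor Δ X := le_mul_of_one_le_right' (hΔ.one_le_initialFactor X)
  have hprod : (allFactors Δ (x * initialFactor Δ X)).prod = x * initialFactor Δ X :=
    hΔ.prod_allFactors (hx.trans hle)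
  rw [(hΔ.isGreedy_allFactors _).take_eq_take_iff (hΔ.isLeftNormalForm X).greedy hΔ
    (hprod.symm ▸ hx.trans hle) hx, hprod]
  calc x * initialFactor Δ X ⊓ Δ ^ k = x ⊓ Δ ^ k
      ↔ x * initialFactor Δ X ⊓ Δ ^ k ≤ x :=
        ⟨fun h => h.trans_le inf_le_left,
          fun h => le_antisymm (le_inf h inf_le_right) (inf_le_inf_right _ hle)⟩
    _ ↔ X * initialFactor Δ X ⊓ Δ ^ (infimum Δ X + k) ≤ X := by
        rw [← mul_le_mul_iff_left (Δ ^ infimum Δ X), mul_inf, ← mul_assoc,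
          hΔ.zpow_infimum_mul_prod_factors, zpow_add, zpow_natCast]

/-- The map `w ↦ X w Δ ^ (-p)`, where `p = inf(X)`. -/
noncomputable def normalizedMul (hΔ : AdmitsLeftNormalForms Δ) (X : G) : InfHom G G where
  toFun w := X * w * Δ ^ (-infimum Δ X)
  map_inf' a b := by rw [mul_inf, hΔ.inf_mul_zpow]

/-- The map `w ↦ X w Δ ^ (-p) ∧ w Δ`, where `p = inf(X)`. If `Y = w⁻¹ X w` also has infimum `p`, it
sends `w` to `w * ι(Y)`, so that its iterates at `1` conjugate `X` to its iterated cyclings. -/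
noncomputable abbrev cyclingMap (hΔ : AdmitsLeftNormalForms Δ) (X : G) : InfHom G G :=
  hΔ.normalizedMul X ⊓ hΔ.mulDelta

theorem normalizedMul_apply (hΔ : AdmitsLeftNormalForms Δ) (X w : G) :
    hΔ.normalizedMul X w = X * w * Δ ^ (-infimum Δ X) :=
  rfl

theorem iterate_normalizedMul (hΔ : AdmitsLeftNormalForms Δ) (X : G) (m : ℕ) (w : G) :
    (hΔ.normalizedMul X)^[m] w = X ^ m * w * Δ ^ (-(m * infimum Δ X)) := by
  induction m with
  | zero => simp
  | succ m ih =>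
    rw [Function.iterate_succ_apply', ih, normalizedMul_apply, ← mul_assoc, ← mul_assoc,
      ← pow_succ', mul_assoc, ← zpow_add]
    congr 2
    push_cast
    ring

theorem commute_normalizedMul_mulDelta (hΔ : AdmitsLeftNormalForms Δ) (X : G) :
    Function.Commute (hΔ.normalizedMul X) hΔ.mulDelta := fun w => by
  simp only [normalizedMul_apply, mulDelta_apply, mul_assoc, ← zpow_one_add, ← zpow_add_one,
    add_comm]

theorem one_le_normalizedMul (hΔ : AdmitsLeftNormalForms Δ) (X : G) :
    1 ≤ hΔ.normalizedMul X 1 := by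
  rw [← hΔ.mul_zpow_le_mul_zpow_iff (infimum Δ X)]
  simpa [normalizedMul_apply] using hΔ.zpow_infimum_le X

theorem cyclingMap_one (hΔ : AdmitsLeftNormalForms Δ) (X : G) :
    hΔ.cyclingMap X 1 = initialFactor Δ X := by
  rw [InfHom.inf_apply, normalizedMul_apply, mulDelta_apply, hΔ.initialFactor_eq, mul_one, one_mul]

theorem normalizedMul_mul (hΔ : AdmitsLeftNormalForms Δ) {X Y w : G} (hw : X * w = w * Y)
    (hp : infimum Δ X = infimum Δ Y) (z : G) :
    hΔ.normalizedMul X (w * z) = w * hΔ.normalizedMul Y z := by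
  simp only [normalizedMul_apply, hp, ← mul_assoc, hw]

theorem cyclingMap_mul (hΔ : AdmitsLeftNormalForms Δ) {X Y w : G} (hw : X * w = w * Y)
    (hp : infimum Δ X = infimum Δ Y) (z : G) :
    hΔ.cyclingMap X (w * z) = w * hΔ.cyclingMap Y z := by
  simp only [InfHom.inf_apply, hΔ.normalizedMul_mul hw hp, mulDelta_apply, mul_inf, mul_assoc]

theorem isRigid_mul_iff (hΔ : AdmitsLeftNormalForms Δ) {X Y w : G} (hw : X * w = w * Y)
    (hp : infimum Δ X = infimum Δ Y) (z : G) (k : ℕ) :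
    IsRigid (hΔ.normalizedMul X) hΔ.mulDelta (w * z) k ↔
      IsRigid (hΔ.normalizedMul Y) hΔ.mulDelta z k := by
  rw [IsRigid, IsRigid, hΔ.cyclingMap_mul hw hp, hΔ.normalizedMul_mul hw hp,
    hΔ.normalizedMul_mul hw hp, iterate_mulDelta, iterate_mulDelta, mul_assoc, ← mul_inf,
    mul_le_mul_iff_left]

theorem isRigid_one_iff (hΔ : AdmitsLeftNormalForms Δ) (X : G) (k : ℕ) :
    IsRigid (hΔ.normalizedMul X) hΔ.mulDelta 1 k ↔
      X * initialFactor Δ X ⊓ Δ ^ (infimum Δ X + k) ≤ X := by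
  rw [IsRigid, hΔ.cyclingMap_one, iterate_mulDelta, normalizedMul_apply, normalizedMul_apply,
    ← hΔ.mul_zpow_le_mul_zpow_iff (infimum Δ X), hΔ.inf_mul_zpow, add_comm, zpow_add, zpow_natCast]
  simp only [mul_assoc, ← zpow_add, neg_add_cancel, zpow_zero, mul_one, one_mul]

open Classical in
theorem le_rigidityCount_iff (hΔ : AdmitsLeftNormalForms Δ) {X : G} {k : ℕ}
    (hk : k ≤ canonicalLength Δ X) :
    k ≤ rigidityCount Δ X ↔ IsRigid (hΔ.normalizedMul X) hΔ.mulDelta 1 k := by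
  refine ⟨fun h => IsRigid.anti hΔ.one_le_mulDelta h ?_, fun h => Nat.le_findGreatest hk ?_⟩
  · rw [hΔ.isRigid_one_iff, ← hΔ.take_allFactors_eq_take_factors_iff]
    exact Nat.findGreatest_spec (P := fun k =>
      (allFactors Δ ((factors Δ X).prod * initialFactor Δ X)).take k = (factors Δ X).take k)
      (Nat.zero_le _) rfl
  · rwa [hΔ.take_allFactors_eq_take_factors_iff, ← hΔ.isRigid_one_iff]

theorem isRigid_rigidityCount (hΔ : AdmitsLeftNormalForms Δ) (X : G) :
    IsRigid (hΔ.normalizedMul X) hΔ.mulDelta 1 (rigidityCount Δ X) :=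
  (hΔ.le_rigidityCount_iff (rigidityCount_le_canonicalLength Δ X)).1 le_rfl

theorem le_rigidity (hΔ : AdmitsLeftNormalForms Δ) {X : G} (hX : canonicalLength Δ X ≠ 0) {q : ℚ}
    (hq : q ≤ 1) {n : ℕ} (hqn : q * canonicalLength Δ X ≤ n)
    (hn : IsRigid (hΔ.normalizedMul X) hΔ.mulDelta 1 n) : q ≤ rigidity Δ X := by
  have hcount : min n (canonicalLength Δ X) ≤ rigidityCount Δ X :=
    (hΔ.le_rigidityCount_iff (min_le_right _ _)).2 (hn.anti hΔ.one_le_mulDelta (min_le_left _ _))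
  rw [rigidity_eq_div, le_div_iff₀ (by positivity)]
  calc q * canonicalLength Δ X ≤ min (n : ℚ) (canonicalLength Δ X) :=
        le_min hqn (mul_le_of_le_one_left (Nat.cast_nonneg _) hq)
    _ ≤ rigidityCount Δ X := mod_cast hcount

section Cycling

variable {X Y : G}

theorem initialFactor_mul_zpow (hΔ : AdmitsLeftNormalForms Δ) (X : G) (q : ℤ) :
    initialFactor Δ X * Δ ^ q = X * Δ ^ (q - infimum Δ X) ⊓ Δ ^ (q + 1) := by
  rw [hΔ.initialFactor_eq, hΔ.inf_mul_zpow, mul_assoc, ← zpow_add, ← zpow_one_add, neg_add_eq_sub,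
    add_comm 1 q]

theorem infimum_le_infimum_cycling (hΔ : AdmitsLeftNormalForms Δ) (X : G) :
    infimum Δ X ≤ infimum Δ (cycling Δ X) := by
  rw [hΔ.le_infimum_iff, ← mul_le_mul_iff_left (initialFactor Δ X), initialFactor_mul_cycling,
    hΔ.initialFactor_mul_zpow, sub_self, zpow_zero, mul_one]
  exact inf_le_left.trans (le_mul_of_one_le_right' (hΔ.one_le_initialFactor X))

theorem cycling_le_zpow (hΔ : AdmitsLeftNormalForms Δ) (X : G) :
    cycling Δ X ≤ Δ ^ (infimum Δ X + canonicalLength Δ X) := by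
  rcases Nat.eq_zero_or_pos (canonicalLength Δ X) with hX | hX
  · rw [hΔ.cycling_eq_self hX]
    exact hΔ.le_zpow_infimum_add_canonicalLength X
  have hΔX : X * initialFactor Δ X ≤ X * Δ :=
    mul_le_mul_right ((hΔ.initialFactor_eq X).trans_le inf_le_right) X
  rw [← mul_le_mul_iff_left (initialFactor Δ X), initialFactor_mul_cycling,
    hΔ.initialFactor_mul_zpow]
  refine le_inf (hΔX.trans ?_) (hΔX.trans ?_)
  · rw [add_sub_cancel_left, mul_le_mul_iff_left]
    simpa using hΔ.zpow_mono (by omega : (1 : ℤ) ≤ canonicalLength Δ X)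
  · rw [zpow_add_one, hΔ.mul_le_mul_iff]
    exact hΔ.le_zpow_infimum_add_canonicalLength X

theorem canonicalLength_cycling_le (hΔ : AdmitsLeftNormalForms Δ) (X : G) :
    canonicalLength Δ (cycling Δ X) ≤ canonicalLength Δ X :=
  hΔ.canonicalLength_le_of_le (hΔ.infimum_le_infimum_cycling X) (hΔ.cycling_le_zpow X)

theorem cycling_mem_superSummitSet (hΔ : AdmitsLeftNormalForms Δ) (hY : Y ∈ superSummitSet Δ X) :
    cycling Δ Y ∈ superSummitSet Δ X :=
  ⟨hY.1.trans (isConj_cycling Δ Y), fun Z hZ => (hΔ.canonicalLength_cycling_le Y).trans (hY.2 Z hZ)⟩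

theorem iterate_cycling_mem_superSummitSet (hΔ : AdmitsLeftNormalForms Δ)
    (hY : Y ∈ superSummitSet Δ X) (t : ℕ) : (cycling Δ)^[t] Y ∈ superSummitSet Δ X :=
  Set.MapsTo.iterate (fun _ => hΔ.cycling_mem_superSummitSet) t hY

theorem canonicalLength_cycling (hΔ : AdmitsLeftNormalForms Δ) (hY : Y ∈ superSummitSet Δ X) :
    canonicalLength Δ (cycling Δ Y) = canonicalLength Δ Y :=
  (hΔ.canonicalLength_cycling_le Y).antisymm (hY.2 _ (hΔ.cycling_mem_superSummitSet hY).1)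

theorem infimum_cycling (hΔ : AdmitsLeftNormalForms Δ) (hY : Y ∈ superSummitSet Δ X) :
    infimum Δ (cycling Δ Y) = infimum Δ Y := by
  rcases Nat.eq_zero_or_pos (canonicalLength Δ Y) with hlength | hlength
  · rw [hΔ.cycling_eq_self hlength]
  refine (hΔ.infimum_le_infimum_cycling Y).antisymm' (le_of_not_gt fun hlt => ?_)
  have hshort : canonicalLength Δ (cycling Δ Y) ≤ canonicalLength Δ Y - 1 :=
    hΔ.canonicalLength_le_of_le (Int.add_one_le_of_lt hlt)
      ((hΔ.cycling_le_zpow Y).trans (hΔ.zpow_mono (by omega)))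
  rw [hΔ.canonicalLength_cycling hY] at hshort
  omega

theorem infimum_iterate_cycling (hΔ : AdmitsLeftNormalForms Δ) (hY : Y ∈ superSummitSet Δ X)
    (t : ℕ) : infimum Δ ((cycling Δ)^[t] Y) = infimum Δ Y := by
  induction t with
  | zero => rfl
  | succ t ih =>
    rw [Function.iterate_succ_apply',
      hΔ.infimum_cycling (hΔ.iterate_cycling_mem_superSummitSet hY t), ih]

theorem mul_iterate_cyclingMap_one (hΔ : AdmitsLeftNormalForms Δ) (hY : Y ∈ superSummitSet Δ X)
    (t : ℕ) :
    Y * (hΔ.cyclingMap Y)^[t] 1 = (hΔ.cyclingMap Y)^[t] 1 * (cycling Δ)^[t] Y := by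
  induction t with
  | zero => simp
  | succ t ih =>
    have hstep := hΔ.cyclingMap_mul ih (hΔ.infimum_iterate_cycling hY t).symm 1
    rw [mul_one, hΔ.cyclingMap_one] at hstep
    rw [Function.iterate_succ_apply', Function.iterate_succ_apply', hstep, ← mul_assoc, ih,
      mul_assoc, mul_assoc, initialFactor_mul_cycling]

theorem isRigid_cycling (hΔ : AdmitsLeftNormalForms Δ) (hY : Y ∈ superSummitSet Δ X) {k : ℕ}
    (h : IsRigid (hΔ.normalizedMul Y) hΔ.mulDelta 1 k) :
    IsRigid (hΔ.normalizedMul (cycling Δ Y)) hΔ.mulDelta 1 k := by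
  rw [← hΔ.isRigid_mul_iff (initialFactor_mul_cycling Δ Y).symm (hΔ.infimum_cycling hY).symm,
    mul_one, ← hΔ.cyclingMap_one]
  exact h.inf_apply (hΔ.commute_normalizedMul_mulDelta Y)

theorem rigidity_le_rigidity_cycling (hΔ : AdmitsLeftNormalForms Δ)
    (hY : Y ∈ superSummitSet Δ X) : rigidity Δ Y ≤ rigidity Δ (cycling Δ Y) := by
  have hlength := hΔ.canonicalLength_cycling hY
  have hcount : rigidityCount Δ Y ≤ rigidityCount Δ (cycling Δ Y) :=
    (hΔ.le_rigidityCount_iff (hlength ▸ rigidityCount_le_canonicalLength Δ Y)).2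
      (hΔ.isRigid_cycling hY (hΔ.isRigid_rigidityCount Y))
  rw [rigidity_eq_div, rigidity_eq_div, hlength]
  gcongr

theorem monotone_rigidity_iterate_cycling (hΔ : AdmitsLeftNormalForms Δ)
    (hY : Y ∈ superSummitSet Δ X) : Monotone fun t => rigidity Δ ((cycling Δ)^[t] Y) :=
  monotone_nat_of_le_succ fun t => by
    rw [Function.iterate_succ_apply']
    exact hΔ.rigidity_le_rigidity_cycling (hΔ.iterate_cycling_mem_superSummitSet hY t)

theorem rigidity_iterate_cycling (hΔ : AdmitsLeftNormalForms Δ) (hY : Y ∈ ultraSummitSet Δ X)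
    (t : ℕ) : rigidity Δ ((cycling Δ)^[t] Y) = rigidity Δ Y := by
  obtain ⟨hYmin, N, hN, hperiodic⟩ := hY
  have hmono := hΔ.monotone_rigidity_iterate_cycling hYmin
  have hfixed : (cycling Δ)^[N * t] Y = Y := by
    rw [Function.iterate_mul]
    exact Function.iterate_fixed hperiodic t
  exact le_antisymm ((hmono (Nat.le_mul_of_pos_left t hN)).trans_eq (by simp only [hfixed]))
    (hmono (Nat.zero_le t))

end Cycling

section Powers

variable {X Y : G} {k m : ℕ}

theorem iterate_normalizedMul_inf_iterate_mulDelta_le (hΔ : AdmitsLeftNormalForms Δ)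
    (hY : Y ∈ ultraSummitSet Δ X) (m : ℕ) :
    (hΔ.normalizedMul Y)^[m] 1 ⊓ hΔ.mulDelta^[m] 1 ≤ (hΔ.cyclingMap Y)^[m] 1 := by
  obtain ⟨hYmin, N, hN, hperiodic⟩ := hY
  set w := (hΔ.cyclingMap Y)^[N * m] 1 with hw
  have hcomm : Y * w = w * Y := by
    rw [hΔ.mul_iterate_cyclingMap_one hYmin, Function.iterate_mul (cycling Δ),
      Function.iterate_fixed hperiodic]
  refine iterate_inf_iterate_le_of_recurrent (g := OrderIso.mulLeft w)
    (hΔ.commute_normalizedMul_mulDelta Y) (hΔ.normalizedMul_mul hcomm rfl)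
    (fun z => mul_assoc w z Δ) (Nat.le_mul_of_pos_left m hN) ?_
  rw [← hw, OrderIso.mulLeft_apply, mul_one]

theorem iterate_normalizedMul_inf_delta (hΔ : AdmitsLeftNormalForms Δ)
    (hY : Y ∈ ultraSummitSet Δ X) (hk : 1 ≤ k)
    (h : IsRigid (hΔ.normalizedMul Y) hΔ.mulDelta 1 k) (hm : 1 ≤ m) :
    (hΔ.normalizedMul Y)^[m] 1 ⊓ Δ = initialFactor Δ Y := by
  rw [← hΔ.cyclingMap_one]
  refine le_antisymm ?_ (le_inf (inf_le_left.trans ?_) (inf_le_right.trans_eq (one_mul Δ)))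
  · simpa only [Function.iterate_one, mulDelta_apply, one_mul] using
      h.iterate_inf_iterate_le (hΔ.commute_normalizedMul_mulDelta Y) (hΔ.one_le_normalizedMul Y)
        hΔ.one_le_mulDelta (hΔ.iterate_normalizedMul_inf_iterate_mulDelta_le hY) hk m 1
  · exact (OrderHomClass.mono (hΔ.normalizedMul Y)).monotone_iterate_of_le_map
      (hΔ.one_le_normalizedMul Y) hm

theorem infimum_pow (hΔ : AdmitsLeftNormalForms Δ) (hY : Y ∈ ultraSummitSet Δ X) (hk : 1 ≤ k)
    (h : IsRigid (hΔ.normalizedMul Y) hΔ.mulDelta 1 k) (hm : 1 ≤ m) :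
    infimum Δ (Y ^ m) = m * infimum Δ Y := by
  have le_infimum_pow_iff (q : ℤ) :
      m * infimum Δ Y + q ≤ infimum Δ (Y ^ m) ↔ Δ ^ q ≤ (hΔ.normalizedMul Y)^[m] 1 := by
    rw [hΔ.le_infimum_iff, iterate_normalizedMul,
      ← hΔ.mul_zpow_le_mul_zpow_iff (-(m * infimum Δ Y)), ← zpow_add, mul_one, add_neg_cancel_comm]
  refine le_antisymm (le_of_not_gt fun hlt => hΔ.initialFactor_ne_delta Y ?_) ?_
  · rw [← hΔ.iterate_normalizedMul_inf_delta hY hk h hm, inf_eq_right]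
    simpa using (le_infimum_pow_iff 1).1 hlt
  · simpa using (le_infimum_pow_iff 0).2 (by
      simpa using (OrderHomClass.mono (hΔ.normalizedMul Y)).monotone_iterate_of_le_map
        (hΔ.one_le_normalizedMul Y) (Nat.zero_le m))

theorem initialFactor_pow (hΔ : AdmitsLeftNormalForms Δ) (hY : Y ∈ ultraSummitSet Δ X)
    (hk : 1 ≤ k) (h : IsRigid (hΔ.normalizedMul Y) hΔ.mulDelta 1 k) (hm : 1 ≤ m) :
    initialFactor Δ (Y ^ m) = initialFactor Δ Y := by
  rw [← hΔ.iterate_normalizedMul_inf_delta hY hk h hm, hΔ.initialFactor_eq,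
    hΔ.infimum_pow hY hk h hm, iterate_normalizedMul, mul_one]

theorem isRigid_pow (hΔ : AdmitsLeftNormalForms Δ) (hY : Y ∈ ultraSummitSet Δ X) (hk : 1 ≤ k)
    (h : IsRigid (hΔ.normalizedMul Y) hΔ.mulDelta 1 k) (hm : 1 ≤ m) :
    IsRigid (hΔ.normalizedMul (Y ^ m)) hΔ.mulDelta 1 (m * k) := by
  have normalizedMul_pow : ⇑(hΔ.normalizedMul (Y ^ m)) = (hΔ.normalizedMul Y)^[m] := by
    funext w
    rw [iterate_normalizedMul, normalizedMul_apply, hΔ.infimum_pow hY hk h hm]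
  exact h.iterate (hΔ.commute_normalizedMul_mulDelta Y) (hΔ.one_le_normalizedMul Y)
    hΔ.one_le_mulDelta (hΔ.iterate_normalizedMul_inf_iterate_mulDelta_le hY) hk normalizedMul_pow

theorem rigidity_le_rigidity_pow (hΔ : AdmitsLeftNormalForms Δ) (hY : Y ∈ ultraSummitSet Δ X)
    (hm : 1 ≤ m) : rigidity Δ Y ≤ rigidity Δ (Y ^ m) := by
  rcases Nat.eq_zero_or_pos (rigidityCount Δ Y) with hcount | hcount
  · rw [rigidity_eq_div Δ Y, hcount, Nat.cast_zero, zero_div]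
    exact rigidity_nonneg Δ _
  have hrigid := hΔ.isRigid_rigidityCount Y
  have hlength : canonicalLength Δ Y ≠ 0 :=
    (hcount.trans_le (rigidityCount_le_canonicalLength Δ Y)).ne'
  have hlength_pow : canonicalLength Δ (Y ^ m) ≠ 0 := by
    rwa [Ne, ← hΔ.initialFactor_eq_one_iff, hΔ.initialFactor_pow hY hcount hrigid hm,
      hΔ.initialFactor_eq_one_iff]
  refine hΔ.le_rigidity hlength_pow (rigidity_le_one Δ Y) ?_
    (hΔ.isRigid_pow hY hcount hrigid hm)
  calc rigidity Δ Y * canonicalLength Δ (Y ^ m)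
      ≤ rigidity Δ Y * (m * canonicalLength Δ Y : ℕ) := by
        gcongr
        · exact rigidity_nonneg Δ Y
        · exact hΔ.canonicalLength_pow_le Y m
    _ = (m * rigidityCount Δ Y : ℕ) := by
        rw [rigidity_eq_div]
        push_cast
        field_simp

end Powers

end AdmitsLeftNormalForms

end Garside

theorem mainTheorem10_general {G : Type*} [Group G] [Lattice G] [MulLeftMono G] (Δ : G)
    (hΔ : Garside.AdmitsLeftNormalForms Δ) (X : G) :
    (X ∈ Garside.ultraSummitSet Δ X →
      ∀ m : ℕ, 1 ≤ m → Garside.rigidity Δ X ≤ Garside.rigidity Δ (X ^ m)) ∧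
    (X ∈ Garside.superSummitSet Δ X →
      ∀ t : ℕ, Garside.rigidity Δ X ≤ Garside.rigidity Δ ((Garside.cycling Δ)^[t] X)) ∧
    (X ∈ Garside.ultraSummitSet Δ X →
      ∀ t : ℕ, Garside.rigidity Δ X = Garside.rigidity Δ ((Garside.cycling Δ)^[t] X)) :=
  ⟨fun hX _ hm => hΔ.rigidity_le_rigidity_pow hX hm,
    fun hX t => hΔ.monotone_rigidity_iterate_cycling hX (Nat.zero_le t),
    fun hX t => (hΔ.rigidity_iterate_cycling hX t).symm⟩

theorem mainTheorem10 {G : Type*} [Group G] [Lattice G] [MulLeftMono G] (Δ : G)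
    (hΔ : Garside.IsGarsideElement Δ) (X : G) (hX : 1 ≤ Garside.canonicalLength Δ X) :
    (X ∈ Garside.ultraSummitSet Δ X →
      ∀ m : ℕ, 1 < m → Garside.rigidity Δ X ≤ Garside.rigidity Δ (X ^ m)) ∧
    (X ∈ Garside.superSummitSet Δ X →
      ∀ t : ℕ, 1 ≤ t → Garside.rigidity Δ X ≤ Garside.rigidity Δ ((Garside.cycling Δ)^[t] X)) ∧
    (X ∈ Garside.ultraSummitSet Δ X →
      ∀ t : ℕ, 1 ≤ t → Garside.rigidity Δ X = Garside.rigidity Δ ((Garside.cycling Δ)^[t] X)) := by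
  obtain ⟨_, hnf⟩ := Garside.exists_leftNormalForm_of_canonicalLength_ne_zero
    (Nat.one_le_iff_ne_zero.1 hX)
  obtain ⟨hpow, hcycling, heq⟩ :=
    mainTheorem10_general Δ (hΔ.admitsLeftNormalForms hnf.ne_one) X
  exact ⟨fun h m hm => hpow h m hm.le, fun h t _ => hcycling h t, fun h t _ => heq h t⟩
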